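/- Let $\Omega\subset\mathbb{R}^2$ be a nonempty bounded open set (for instance, a bounded, connected Lipschitz domain). For every real constant $c\neq 0$, the problem of minimising $$\frac12\int_\Omega\bigl(|\nabla u(x)|^2+|\nabla v(x)|^2\bigr)\,dx$$ over all $(u,v)\in H^1(\Omega;\mathbb{R}^2)$ subject to the constraint $$\int_\Omega\det(\nabla u(x),\nabla v(x))\,dx=c$$ has a minimiser: there is a pair $(u_c,v_c)\in H^1(\Omega;\mathbb{R}^2)$ that satisfies the constraint and whose energy is at most that of every pair in $H^1(\Omega;\mathbb{R}^2)$ satisfying the constraint. Here $\nabla$ is the weak gradient and $\det(a,b)=a_1b_2-a_2b_1$ for $a,b\in\mathbb{R}^2$. -/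

import Mathlib

open MeasureTheory Set

open scoped ContDiff

noncomputable section

/-- The Euclidean plane `ℝ²`. -/
abbrev Plane : Type := EuclideanSpace ℝ (Fin 2)

/-- `G` is a weak gradient of `u` in `Ω`: for every test function `φ ∈ C_c^∞(Ω)` and each
coordinate `i`, `∫_Ω u ∂ᵢφ = - ∫_Ω Gᵢ φ`. -/
def IsWeakGradient (Ω : Set Plane) (u : Plane → ℝ) (G : Plane → Plane) : Prop :=
  ∀ φ : Plane → ℝ, ContDiff ℝ ∞ φ → HasCompactSupport φ → tsupport φ ⊆ Ω →
    ∀ i : Fin 2,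
      ∫ x in Ω, u x * fderiv ℝ φ x (EuclideanSpace.single i 1) = -∫ x in Ω, G x i * φ x

/-- `u ∈ H¹(Ω)`: `u` is in `L²(Ω)` and has a weak gradient in `L²(Ω; ℝ²)`. -/
def MemH1 (Ω : Set Plane) (u : Plane → ℝ) : Prop :=
  MemLp u 2 (volume.restrict Ω) ∧
    ∃ G : Plane → Plane, MemLp G 2 (volume.restrict Ω) ∧ IsWeakGradient Ω u G

open Classical in
/-- The weak gradient `∇u ∈ L²(Ω; ℝ²)` of `u ∈ H¹(Ω)`, which on an open set is unique up to
equality almost everywhere in `Ω`. It is only used for `u ∈ H¹(Ω)`; elsewhere it is set to `0`. -/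
def weakGrad (Ω : Set Plane) (u : Plane → ℝ) : Plane → Plane :=
  if h : MemH1 Ω u then h.2.choose else 0

/-- The determinant of the matrix with rows `a` and `b`. -/
def planeDet (a b : Plane) : ℝ := !![a 0, a 1; b 0, b 1].det

/-- The energy `½ ∫_Ω (|∇u|² + |∇v|²)` of a pair `(u, v)`. -/
def dirichletEnergy (Ω : Set Plane) (p : (Plane → ℝ) × (Plane → ℝ)) : ℝ :=
  (1 / 2) * ∫ x in Ω, (‖weakGrad Ω p.1 x‖ ^ 2 + ‖weakGrad Ω p.2 x‖ ^ 2)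

/-- The pairs `(u, v) ∈ H¹(Ω; ℝ²)` with `∫_Ω det(∇u, ∇v) = c`. -/
def admissiblePairs (Ω : Set Plane) (c : ℝ) : Set ((Plane → ℝ) × (Plane → ℝ)) :=
  {p | MemH1 Ω p.1 ∧ MemH1 Ω p.2 ∧
    ∫ x in Ω, planeDet (weakGrad Ω p.1 x) (weakGrad Ω p.2 x) = c}

end

/-! Integrating `abs_planeDet_le` bounds every admissible energy below by `|c|`. Equality holds for
linear conformal or anticonformal maps; with no boundary condition and Ω bounded, these are
admissible after scaling, so no compactness argument is needed. Since `weakGrad` is an arbitrary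
choice, computing it on linear maps needs a.e. uniqueness. -/

/-- Integrable weak gradients on an open set are unique almost everywhere. -/
theorem IsWeakGradient.ae_eq {Ω : Set Plane} (hΩ : IsOpen Ω) {u : Plane → ℝ}
    {G H : Plane → Plane} (hG : IsWeakGradient Ω u G) (hH : IsWeakGradient Ω u H)
    (hGi : Integrable G (volume.restrict Ω)) (hHi : Integrable H (volume.restrict Ω)) :
    G =ᵐ[volume.restrict Ω] H := by
  have key : ∀ i : Fin 2, ∀ᵐ x ∂(volume.restrict Ω), G x i = H x i := by
    intro i
    have hg : Integrable (fun x => G x i) (volume.restrict Ω) := hGi.eval_piLp i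
    have hh : Integrable (fun x => H x i) (volume.restrict Ω) := hHi.eval_piLp i
    have hgh : Integrable (fun x => G x i - H x i) (volume.restrict Ω) := hg.sub hh
    have h0 := hΩ.ae_eq_zero_of_integral_contDiff_smul_eq_zero (μ := volume.restrict Ω)
      (f := fun x => G x i - H x i) (hgh.locallyIntegrable.locallyIntegrableOn Ω)
      (by
        intro φ hφ hc hs
        have hφb : ∃ C, ∀ x, ‖φ x‖ ≤ C :=
          hφ.continuous.bounded_above_of_compact_support hc
        obtain ⟨C, hC⟩ := hφb
        have e := (hG φ hφ hc hs i).symm.trans (hH φ hφ hc hs i)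
        have h1 : Integrable (fun x => G x i * φ x) (volume.restrict Ω) :=
          hg.mul_bdd hφ.continuous.aestronglyMeasurable (Filter.Eventually.of_forall hC)
        have h2 : Integrable (fun x => H x i * φ x) (volume.restrict Ω) :=
          hh.mul_bdd hφ.continuous.aestronglyMeasurable (Filter.Eventually.of_forall hC)
        have : (fun x => φ x • (G x i - H x i)) = fun x => G x i * φ x - H x i * φ x := by
          funext x; simp only [smul_eq_mul]; ring
        rw [this, integral_sub h1 h2]
        linarith)
    filter_upwards [h0, ae_restrict_mem hΩ.measurableSet] with x hx hxΩ
    exact sub_eq_zero.mp (hx hxΩ)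
  filter_upwards [key 0, key 1] with x h0 h1
  ext i
  fin_cases i
  · exact h0
  · exact h1

/-- A linear function `x ↦ a xᵢ` has the constant weak gradient `a eᵢ`. -/
theorem isWeakGradient_mul_coord (Ω : Set Plane) (a : ℝ) (i : Fin 2) :
    IsWeakGradient Ω (fun x => a * x i) (fun _ => EuclideanSpace.single i a) := by
  intro φ hφ hc hs j
  have hd : ∀ x : Plane, HasFDerivAt (fun x : Plane => a * x i)
      (a • (EuclideanSpace.proj i : Plane →L[ℝ] ℝ)) x := fun x =>
    (EuclideanSpace.proj i : Plane →L[ℝ] ℝ).hasFDerivAt.const_mul a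
  have hder : ∀ x : Plane, fderiv ℝ (fun x : Plane => a * x i) x (EuclideanSpace.single j 1) =
      (EuclideanSpace.single i a : Plane) j := by
    intro x
    rw [(hd x).fderiv]
    fin_cases i <;> fin_cases j <;> simp
  have hcont : Continuous fun x : Plane => a * x i := by fun_prop
  have hφ1 : ContDiff ℝ 1 φ := hφ.of_le (by exact_mod_cast le_top)
  have hφ' : Continuous fun x => fderiv ℝ φ x (EuclideanSpace.single j 1) :=
    (hφ1.continuous_fderiv one_ne_zero).clm_apply continuous_const
  have hc' : HasCompactSupport fun x => fderiv ℝ φ x (EuclideanSpace.single j 1) :=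
    hc.fderiv_apply ℝ _
  have hφ0 : ∀ x, x ∉ Ω → φ x = 0 := fun x hx => image_eq_zero_of_notMem_tsupport fun h => hx (hs h)
  have hφ'0 : ∀ x, x ∉ Ω → fderiv ℝ φ x = 0 := fun x hx =>
    fderiv_of_notMem_tsupport ℝ fun h => hx (hs h)
  -- As φ is supported in Ω, both integrals extend to the whole plane, where integration by parts
  -- has no boundary term.
  rw [setIntegral_eq_integral_of_forall_compl_eq_zero (fun x hx => by simp [hφ'0 x hx]),
    setIntegral_eq_integral_of_forall_compl_eq_zero (fun x hx => by simp [hφ0 x hx]),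
    integral_mul_fderiv_eq_neg_fderiv_mul_of_integrable]
  · simp only [hder]
  · simp only [hder]
    exact (continuous_const.mul hφ.continuous).integrable_of_hasCompactSupport hc.mul_left
  · exact (hcont.mul hφ').integrable_of_hasCompactSupport hc'.mul_left
  · exact (hcont.mul hφ.continuous).integrable_of_hasCompactSupport hc.mul_left
  · exact fun x _ => (hd x).differentiableAt
  · exact fun x _ => hφ1.differentiable one_ne_zero x

theorem memH1_mul_coord {Ω : Set Plane} (hΩ : IsOpen Ω) (hb : Bornology.IsBounded Ω)
    (a : ℝ) (i : Fin 2) : MemH1 Ω (fun x => a * x i) := by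
  have : IsFiniteMeasure (volume.restrict Ω) := ⟨by simpa using hb.measure_lt_top⟩
  refine ⟨?_, _, memLp_const _, isWeakGradient_mul_coord Ω a i⟩
  obtain ⟨R, hR⟩ := hb.exists_norm_le
  refine MemLp.of_bound (by fun_prop) (|a| * R) ?_
  filter_upwards [ae_restrict_mem hΩ.measurableSet] with x hx
  rw [norm_mul, Real.norm_eq_abs]
  exact mul_le_mul_of_nonneg_left ((PiLp.norm_apply_le x i).trans (hR x hx)) (abs_nonneg a)

theorem MemH1.memLp_weakGrad {Ω : Set Plane} {u : Plane → ℝ} (h : MemH1 Ω u) :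
    MemLp (weakGrad Ω u) 2 (volume.restrict Ω) := by
  rw [weakGrad, dif_pos h]
  exact h.2.choose_spec.1

theorem MemH1.isWeakGradient_weakGrad {Ω : Set Plane} {u : Plane → ℝ} (h : MemH1 Ω u) :
    IsWeakGradient Ω u (weakGrad Ω u) := by
  rw [weakGrad, dif_pos h]
  exact h.2.choose_spec.2

theorem weakGrad_mul_coord {Ω : Set Plane} (hΩ : IsOpen Ω) (hb : Bornology.IsBounded Ω)
    (a : ℝ) (i : Fin 2) :
    weakGrad Ω (fun x => a * x i) =ᵐ[volume.restrict Ω] fun _ => EuclideanSpace.single i a := by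
  have : IsFiniteMeasure (volume.restrict Ω) := ⟨by simpa using hb.measure_lt_top⟩
  have h := memH1_mul_coord hΩ hb a i
  exact h.isWeakGradient_weakGrad.ae_eq hΩ (isWeakGradient_mul_coord Ω a i)
    (h.memLp_weakGrad.integrable one_le_two) (integrable_const _)

/-- Twice the gap is a sum of two squares, which vanish exactly under the Cauchy–Riemann equations
or their orientation-reversed form. -/
theorem abs_planeDet_le (a b : Plane) : |planeDet a b| ≤ (1 / 2) * (‖a‖ ^ 2 + ‖b‖ ^ 2) := by
  rw [planeDet, Matrix.det_fin_two_of, EuclideanSpace.real_norm_sq_eq,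
    EuclideanSpace.real_norm_sq_eq, Fin.sum_univ_two, Fin.sum_univ_two, abs_le]
  constructor
  · nlinarith [sq_nonneg (a 0 + b 1), sq_nonneg (a 1 - b 0)]
  · nlinarith [sq_nonneg (a 0 - b 1), sq_nonneg (a 1 + b 0)]

/-- The energy of an admissible pair is at least `|c|`. -/
theorem abs_le_dirichletEnergy {Ω : Set Plane} {c : ℝ} {p : (Plane → ℝ) × (Plane → ℝ)}
    (hp : p ∈ admissiblePairs Ω c) : |c| ≤ dirichletEnergy Ω p := by
  obtain ⟨hu, hv, rfl⟩ := hp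
  rw [dirichletEnergy, ← integral_const_mul, ← Real.norm_eq_abs]
  have hu2 := (memLp_two_iff_integrable_sq_norm hu.memLp_weakGrad.1).1 hu.memLp_weakGrad
  have hv2 := (memLp_two_iff_integrable_sq_norm hv.memLp_weakGrad.1).1 hv.memLp_weakGrad
  exact norm_integral_le_of_norm_le ((hu2.add hv2).const_mul (1 / 2))
    (Filter.Eventually.of_forall fun x => abs_planeDet_le _ _)

/-- The energy is bounded below by `|c|`, and a multiple of the identity (for `c > 0`) or of a
reflection (for `c < 0`) attains this bound. -/
theorem mainTheorem8 (Ω : Set Plane) (hopen : IsOpen Ω) (hne : Ω.Nonempty)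
    (hbdd : Bornology.IsBounded Ω) (c : ℝ) (hc : c ≠ 0) :
    ∃ p ∈ admissiblePairs Ω c, IsMinOn (dirichletEnergy Ω) (admissiblePairs Ω c) p := by
  have hV : 0 < volume.real Ω :=
    ENNReal.toReal_pos (hopen.measure_pos volume hne).ne' hbdd.measure_lt_top.ne
  -- `s` is the sign of `c` and fixes the orientation; `l` is the scale at which the determinant
  -- integrates to `c`.
  obtain ⟨s, hs, hsc⟩ : ∃ s : ℝ, s ^ 2 = 1 ∧ s * |c| = c := by
    rcases lt_or_gt_of_ne hc with h | h
    · exact ⟨-1, by norm_num, by rw [abs_of_neg h]; ring⟩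
    · exact ⟨1, by norm_num, by rw [abs_of_pos h]; ring⟩
  obtain ⟨l, hl⟩ : ∃ l : ℝ, l ^ 2 * volume.real Ω = |c| :=
    ⟨√(|c| / volume.real Ω), by rw [Real.sq_sqrt (by positivity)]; field_simp⟩
  have hG0 := weakGrad_mul_coord hopen hbdd l 0
  have hG1 := weakGrad_mul_coord hopen hbdd (s * l) 1
  refine ⟨(fun x => l * x 0, fun x => s * l * x 1),
    ⟨memH1_mul_coord hopen hbdd l 0, memH1_mul_coord hopen hbdd (s * l) 1, ?_⟩, ?_⟩
  · have : (fun x => planeDet (weakGrad Ω (fun x => l * x 0) x)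
        (weakGrad Ω (fun x => s * l * x 1) x)) =ᵐ[volume.restrict Ω] fun _ => s * l ^ 2 := by
      filter_upwards [hG0, hG1] with x h0 h1
      rw [h0, h1, planeDet, Matrix.det_fin_two_of]
      simp
      ring
    rw [integral_congr_ae this, setIntegral_const, smul_eq_mul]
    linear_combination s * hl + hsc
  · intro q hq
    refine le_trans (le_of_eq ?_) (abs_le_dirichletEnergy hq)
    have : (fun x => ‖weakGrad Ω (fun x => l * x 0) x‖ ^ 2 +
        ‖weakGrad Ω (fun x => s * l * x 1) x‖ ^ 2) =ᵐ[volume.restrict Ω] fun _ => 2 * l ^ 2 := by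
      filter_upwards [hG0, hG1] with x h0 h1
      rw [h0, h1, PiLp.norm_single, PiLp.norm_single, Real.norm_eq_abs,
        Real.norm_eq_abs, sq_abs, sq_abs]
      linear_combination l ^ 2 * hs
    rw [dirichletEnergy, integral_congr_ae this, setIntegral_const, smul_eq_mul]
    linear_combination hl
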